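/- For $n\in\mathbb N=\{0,1,2,\dots\}$ let $f(n)=\sum_{k=0}^n\binom nk^{-1}\in\mathbb Q$. Let $\nu_p$ denote the exponent of a prime $p$ in a rational number, and call $p$ good if $\nu_p(f(n))\le 1$ for all integers $n$ with $1\le n\le p-2$. For a $p$-adic integer $x=\sum_{i=0}^\infty\varepsilon_ip^i$ with $\varepsilon_i\in\{0,\dots,p-1\}$, put $x_n=\sum_{i=0}^n\varepsilon_ip^i\in\mathbb N$, and say that $\bar f(x)$ is $p$-definable if $\lim_{n\to\infty}f(x_n)$ exists in $\mathbb Q_p$. Theorem. Let $p$ be a good odd prime or $p=23$. Then $\bar f(x)$ is not $p$-definable for every $x\in\mathbb Z_p\setminus\{-1,0,1,2,\dots\}$. Hence $-1$ is the only element $x$ of $\mathbb Z_p\setminus\mathbb N$ for which $\bar f(x)$ is $p$-definable; in particular, $\bar f(-1)$ is $p$-definable. -/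

import Mathlib

open Filter Topology

/-- `f(n) = ∑_{k=0}^n (n choose k)⁻¹`, a positive rational number. -/
def invBinomSum (n : ℕ) : ℚ :=
  ∑ k ∈ Finset.range (n + 1), ((n.choose k : ℕ) : ℚ)⁻¹

/-- `p` is good: `ν_p(f(n)) ≤ 1` for all `n` with `1 ≤ n ≤ p - 2`. -/
def IsGood (p : ℕ) : Prop :=
  ∀ n : ℕ, 1 ≤ n → n + 2 ≤ p → padicValRat p (invBinomSum n) ≤ 1

/-- The `i`-th digit `ε_i ∈ {0, …, p - 1}` in the expansion `x = ∑ ε_i p^i`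
(`x.appr (i + 1)` is the residue of `x` modulo `p ^ (i + 1)` in `[0, p ^ (i + 1))`). -/
noncomputable def padicDigit {p : ℕ} [Fact p.Prime] (x : ℤ_[p]) (i : ℕ) : ℕ :=
  x.appr (i + 1) / p ^ i

/-- The partial sum `x_n = ∑_{i=0}^n ε_i p^i`. -/
noncomputable def padicPartialSum {p : ℕ} [Fact p.Prime] (x : ℤ_[p]) (n : ℕ) : ℕ :=
  ∑ i ∈ Finset.range (n + 1), padicDigit x i * p ^ i

/-- `f` is `p`-definable at `x`: the limit of `f(x_n)` exists in `ℚ_p`. -/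
def IsPDefinable {p : ℕ} [Fact p.Prime] (x : ℤ_[p]) : Prop :=
  ∃ L : ℚ_[p], Tendsto (fun n : ℕ => ((invBinomSum (padicPartialSum x n) : ℚ) : ℚ_[p])) atTop (𝓝 L)

/-- The digits lie in `{0, …, p - 1}`. -/
theorem padicDigit_lt {p : ℕ} [Fact p.Prime] (x : ℤ_[p]) (i : ℕ) : padicDigit x i < p := by
  unfold padicDigit
  rw [Nat.div_lt_iff_lt_mul (pow_pos (Fact.out : p.Prime).pos i), ← pow_succ']
  exact x.appr_lt (i + 1)

theorem padicPartialSum_eq_appr {p : ℕ} [Fact p.Prime] (x : ℤ_[p]) (n : ℕ) :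
    padicPartialSum x n = x.appr (n + 1) := by
  have key : ∀ m : ℕ, ∑ i ∈ Finset.range m, padicDigit x i * p ^ i = x.appr m := by
    intro m
    induction m with
    | zero => simp [PadicInt.appr]
    | succ m ih =>
      rw [Finset.sum_range_succ, ih]
      obtain ⟨c, hc⟩ := x.dvd_appr_sub_appr m (m + 1) (Nat.le_succ m)
      have hle : x.appr m ≤ x.appr (m + 1) := x.appr_mono (Nat.le_succ m)
      have h : x.appr (m + 1) = x.appr m + p ^ m * c := by omega
      have hd : padicDigit x m = c := by
        unfold padicDigit
        rw [h, Nat.add_mul_div_left _ _ (pow_pos (Fact.out : p.Prime).pos m),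
          Nat.div_eq_of_lt (x.appr_lt m), zero_add]
      rw [hd, h, mul_comm]
  exact key (n + 1)

/-- The partial sums converge to `x`, so the digits are those of the `p`-adic expansion of `x`. -/
theorem tendsto_padicPartialSum {p : ℕ} [Fact p.Prime] (x : ℤ_[p]) :
    Tendsto (fun n : ℕ => ((padicPartialSum x n : ℕ) : ℤ_[p])) atTop (𝓝 x) := by
  have hp : (1 : ℝ) < p := by exact_mod_cast (Fact.out : p.Prime).one_lt
  rw [tendsto_iff_norm_sub_tendsto_zero]
  have hz : Tendsto (fun n : ℕ => ((p : ℝ)⁻¹) ^ (n + 1)) atTop (𝓝 0) :=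
    (tendsto_pow_atTop_nhds_zero_of_lt_one (by positivity) (inv_lt_one_of_one_lt₀ hp)).comp
      (tendsto_add_atTop_nat 1)
  refine squeeze_zero (fun _ => norm_nonneg _) (fun n => ?_) hz
  rw [padicPartialSum_eq_appr, norm_sub_rev]
  have h := (PadicInt.norm_le_pow_iff_mem_span_pow _ (n + 1)).2 (x.appr_spec (n + 1))
  rwa [zpow_neg, zpow_natCast, ← inv_pow] at h

/-! Put `T(N) = ∑_{k ≤ N} 2^k / k`. Then `f(n) = (n + 1) / 2^(n + 1) * T(n + 1)` (`invBinomSum_eq`).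
If `x ≠ -1`, the norms of `x_n + 1` stabilise at a nonzero value, so convergence of `f(x_n)` bounds
`T(x_n + 1)`, and `p^n T(a_n + 1) → 0`, where `a_n` is `x` modulo `p^n`.

Splitting off the leading digit `ε_n` of `a_(n+1)` and using `p T(pM) ≡ T(M)` mod `p²`
(`prime_mul_twoPowSum_sub_mem`), this forces `T(ε_n) ≡ 0` mod `p²` for large `n`. For a good prime
no nonzero digit satisfies this, so the digits end in zeros and `x` is a natural number. For `p =
23` the digit 13 is not excluded; the expansion modulo `p³`, which also involves the preceding
digit, rules it out.

At `-1`, `x_n + 1 = p^(n+1)`, and both `p^n T(p^n)` and the units `2^(p^n)` are Cauchy. -/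

/-! ### Powers of the maximal ideal inside `ℚ_[p]` -/

/-- The subgroup `p ^ k ℤ_p` of `ℚ_p`. -/
def padicBall (p : ℕ) [Fact p.Prime] (k : ℕ) : AddSubgroup ℚ_[p] where
  carrier := {x | ‖x‖ ≤ (p : ℝ)⁻¹ ^ k}
  zero_mem' := by simp only [Set.mem_ofPred_eq, norm_zero]; positivity
  add_mem' := fun {a b} ha hb => (Padic.nonarchimedean a b).trans (max_le ha hb)
  neg_mem' := fun {a} ha => by simpa using ha

section Ball

variable {p : ℕ} [hpp : Fact p.Prime]

theorem mem_padicBall {k : ℕ} {x : ℚ_[p]} : x ∈ padicBall p k ↔ ‖x‖ ≤ (p : ℝ)⁻¹ ^ k := Iff.rfl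

theorem mem_padicBall_zero {x : ℚ_[p]} : x ∈ padicBall p 0 ↔ ‖x‖ ≤ 1 := by simp [mem_padicBall]

theorem mul_mem_padicBall {j k : ℕ} {x y : ℚ_[p]} (hx : x ∈ padicBall p j)
    (hy : y ∈ padicBall p k) : x * y ∈ padicBall p (j + k) := by
  rw [mem_padicBall] at *
  rw [norm_mul, pow_add]
  exact mul_le_mul hx hy (norm_nonneg _) (by positivity)

theorem mul_left_mem_padicBall {k : ℕ} {x y : ℚ_[p]} (hx : ‖x‖ ≤ 1)
    (hy : y ∈ padicBall p k) : x * y ∈ padicBall p k := by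
  simpa using mul_mem_padicBall (mem_padicBall_zero.2 hx) hy

theorem padicBall_anti {j k : ℕ} (h : j ≤ k) : padicBall p k ≤ padicBall p j := by
  intro x hx
  rw [mem_padicBall] at *
  have hp : (1 : ℝ) ≤ p := by exact_mod_cast hpp.out.one_lt.le
  exact hx.trans (pow_le_pow_of_le_one (by positivity) (inv_le_one_of_one_le₀ hp) h)

theorem pow_mem_padicBall (k : ℕ) : (p : ℚ_[p]) ^ k ∈ padicBall p k := by
  rw [mem_padicBall, norm_pow, Padic.norm_p]

theorem prime_mem_padicBall : (p : ℚ_[p]) ∈ padicBall p 1 := by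
  simpa using pow_mem_padicBall (p := p) 1

theorem intCast_mem_padicBall {k : ℕ} {z : ℤ} :
    (z : ℚ_[p]) ∈ padicBall p k ↔ (p : ℤ) ^ k ∣ z := by
  rw [mem_padicBall]
  have := Padic.norm_int_le_pow_iff_dvd (p := p) z k
  rw [zpow_neg, zpow_natCast, ← inv_pow] at this
  exact_mod_cast this

theorem norm_natCast_le_one (n : ℕ) : ‖(n : ℚ_[p])‖ ≤ 1 := by
  exact_mod_cast Padic.norm_int_le_one (p := p) n

theorem mem_padicBall_of_mul {k : ℕ} {u x : ℚ_[p]} (hu : ‖u‖ = 1) (h : u * x ∈ padicBall p k) :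
    x ∈ padicBall p k := by
  rwa [mem_padicBall, norm_mul, hu, one_mul] at h

theorem mem_padicBall_of_prime_mul {k : ℕ} {x : ℚ_[p]}
    (h : (p : ℚ_[p]) * x ∈ padicBall p (k + 1)) : x ∈ padicBall p k := by
  rw [mem_padicBall] at *
  have hp : (0 : ℝ) < p := by exact_mod_cast hpp.out.pos
  rw [norm_mul, Padic.norm_p, pow_succ'] at h
  exact le_of_mul_le_mul_left h (by positivity)

theorem div_mem_padicBall {k : ℕ} {u x : ℚ_[p]} (hu : ‖u‖ = 1) (h : x ∈ padicBall p k) :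
    x / u ∈ padicBall p k := by
  rwa [mem_padicBall, norm_div, hu, div_one]

theorem norm_natCast_eq_one_of_not_dvd {n : ℕ} (h : ¬ p ∣ n) : ‖(n : ℚ_[p])‖ = 1 := by
  rw [Padic.norm_natCast_eq_one_iff]
  exact (Nat.Prime.coprime_iff_not_dvd hpp.out).2 h

/-- If `k < p ^ (m + 1)` is positive, then `p ^ m / k` is a `p`-adic integer. -/
theorem norm_pow_div_natCast_le_one {m k : ℕ} (hk : ¬ p ^ (m + 1) ∣ k) :
    ‖(p : ℚ_[p]) ^ m / k‖ ≤ 1 := by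
  have h0 : k ≠ 0 := by rintro rfl; simp at hk
  obtain ⟨v, u, hu, rfl⟩ := Nat.exists_eq_pow_mul_and_not_dvd h0 p hpp.out.ne_one
  have hv : v ≤ m := by
    by_contra! h
    exact hk (Dvd.dvd.mul_right (pow_dvd_pow p h) u)
  obtain ⟨w, rfl⟩ := Nat.exists_eq_add_of_le hv
  have hp : (p : ℚ_[p]) ≠ 0 := by exact_mod_cast hpp.out.ne_zero
  have h1 := norm_natCast_eq_one_of_not_dvd hu
  have : (p : ℚ_[p]) ^ (v + w) / ((p ^ v * u : ℕ) : ℚ_[p]) = (p : ℚ_[p]) ^ w / u := by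
    push_cast
    rw [pow_add, mul_div_mul_left _ _ (pow_ne_zero _ hp)]
  rw [this, norm_div, h1, div_one]
  exact_mod_cast norm_natCast_le_one (p := p) (p ^ w)

theorem norm_two_eq_one (hodd : Odd p) : ‖(2 : ℚ_[p])‖ = 1 := by
  have : ¬ p ∣ 2 := by
    intro h
    have := (Nat.prime_dvd_prime_iff_eq hpp.out Nat.prime_two).1 h
    subst this
    exact absurd hodd (by decide)
  exact_mod_cast norm_natCast_eq_one_of_not_dvd this

theorem norm_two_pow_eq_one (hodd : Odd p) (n : ℕ) : ‖(2 : ℚ_[p]) ^ n‖ = 1 := by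
  rw [norm_pow, norm_two_eq_one hodd, one_pow]

/-- Fermat's little theorem for powers of two. -/
theorem two_pow_prime_mul_sub_mem (m : ℕ) :
    (2 : ℚ_[p]) ^ (p * m) - 2 ^ m ∈ padicBall p 1 := by
  have h : (p : ℤ) ∣ 2 ^ (p * m) - 2 ^ m := by
    rw [← ZMod.intCast_eq_intCast_iff_dvd_sub]
    push_cast
    rw [pow_mul, ZMod.pow_card]
  have := (intCast_mem_padicBall (p := p) (k := 1)).2 (by simpa using h)
  simpa using this

theorem two_pow_pow_mul_sub_mem (n m : ℕ) :
    (2 : ℚ_[p]) ^ (p ^ n * m) - 2 ^ m ∈ padicBall p 1 := by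
  induction n with
  | zero => simp [zero_mem]
  | succ n ih =>
    convert add_mem (two_pow_prime_mul_sub_mem (p := p) (p ^ n * m)) ih using 1
    rw [show p ^ (n + 1) * m = p * (p ^ n * m) by ring]; ring

/-- `C(p - 1, i) ≡ (-1)^i` modulo `p`. -/
theorem prime_dvd_choose_sub_neg_one_pow {i : ℕ} (hi : i < p) :
    (p : ℤ) ∣ ((p - 1).choose i : ℤ) - (-1) ^ i := by
  induction i with
  | zero => simp
  | succ i ih =>
    have h1 := ih (by omega)
    have h2 : (p : ℤ) ∣ ((p.choose (i + 1) : ℕ) : ℤ) :=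
      Int.natCast_dvd_natCast.2 (hpp.out.dvd_choose_self (by omega) hi)
    have h3 : p.choose (i + 1) = (p - 1).choose i + (p - 1).choose (i + 1) := by
      conv_lhs => rw [← Nat.sub_add_cancel hpp.out.one_le]
      rw [Nat.choose_succ_succ]
    rw [h3] at h2
    have h4 := dvd_sub h2 h1
    have e : (((p - 1).choose i + (p - 1).choose (i + 1) : ℕ) : ℤ) - ((p - 1).choose i - (-1) ^ i) =
        (p - 1).choose (i + 1) - (-1) ^ (i + 1) := by
      rw [Nat.cast_add, pow_succ]; ring
    rwa [e] at h4

/-- The sum `∑_{0 < a < p} 2^a / a` is `-2` times the Fermat quotient of `2`, modulo `p`. -/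
theorem sum_two_pow_div_add_mem (hodd : Odd p) :
    (p : ℚ_[p]) * ∑ i ∈ Finset.range (p - 1), (2 : ℚ_[p]) ^ (i + 1) / ((i + 1 : ℕ) : ℚ_[p])
      + (2 ^ p - 2) ∈ padicBall p 2 := by
  -- This is the binomial expansion of `(-2 + 1)^p = -1` with its two end terms removed.
  have hbin : (2 : ℚ_[p]) ^ p - 2 =
      ∑ i ∈ Finset.range (p - 1), (-2 : ℚ_[p]) ^ (i + 1) * (p.choose (i + 1) : ℚ_[p]) := by
    have h := add_pow (-2 : ℚ_[p]) 1 p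
    rw [Finset.sum_range_succ] at h
    obtain ⟨s, hs⟩ : ∃ s, p = s + 1 := ⟨p - 1, by have := hpp.out.pos; omega⟩
    have e : (-2 + 1 : ℚ_[p]) = -1 := by norm_num
    rw [e, hodd.neg_one_pow, hodd.neg_pow] at h
    have h4 : ∑ m ∈ Finset.range p, (-2 : ℚ_[p]) ^ m * 1 ^ (p - m) * (p.choose m : ℚ_[p]) =
      (∑ i ∈ Finset.range (p - 1), (-2 : ℚ_[p]) ^ (i + 1) * (p.choose (i + 1) : ℚ_[p])) + 1 := by
      conv_lhs => rw [show Finset.range p = Finset.range (p - 1 + 1) by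
        rw [Nat.sub_add_cancel hpp.out.one_le]]
      rw [Finset.sum_range_succ']
      simp
    rw [h4] at h
    simp at h
    linear_combination h
  rw [hbin, Finset.mul_sum, ← Finset.sum_add_distrib]
  refine sum_mem fun i hi => ?_
  have hi' : i + 1 < p := by have := Finset.mem_range.1 hi; omega
  have hu : ‖((i + 1 : ℕ) : ℚ_[p])‖ = 1 :=
    norm_natCast_eq_one_of_not_dvd (Nat.not_dvd_of_pos_of_lt (Nat.succ_pos _) hi')
  have hne : ((i + 1 : ℕ) : ℚ_[p]) ≠ 0 := by exact_mod_cast Nat.succ_ne_zero i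
  have hc : (p : ℚ_[p]) * ((p - 1).choose i : ℚ_[p]) =
      (p.choose (i + 1) : ℚ_[p]) * ((i + 1 : ℕ) : ℚ_[p]) := by
    have := Nat.add_one_mul_choose_eq (p - 1) i
    rw [Nat.sub_add_cancel hpp.out.one_le] at this
    exact_mod_cast this
  have hd := (intCast_mem_padicBall (p := p) (k := 1)).2
    (by simpa using prime_dvd_choose_sub_neg_one_pow (p := p) (i := i) (by omega))
  push_cast at hd
  have h2 : ‖(-2 : ℚ_[p]) ^ (i + 1)‖ ≤ 1 := by
    rw [norm_pow, norm_neg, norm_two_eq_one hodd, one_pow]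
  refine mem_padicBall_of_mul hu ?_
  convert mul_left_mem_padicBall h2 (mul_mem_padicBall (prime_mem_padicBall (p := p)) hd) using 1
  rw [mul_sub, hc, neg_pow (2 : ℚ_[p])]
  have hs : ((-1 : ℚ_[p]) ^ i) * (-1) ^ i = 1 := by rw [← mul_pow]; simp
  field_simp
  rw [pow_succ (-1 : ℚ_[p])]
  linear_combination (-(p : ℚ_[p])) * hs

/-- For `z` divisible by the odd prime `p`, `((1 + z)^l - 1) / l ≡ z` modulo `p²`. -/
theorem one_add_pow_sub_one_div_sub_mem (hodd : Odd p) {z : ℚ_[p]} (hz : z ∈ padicBall p 1)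
    (l : ℕ) (hl : l ≠ 0) : ((1 + z) ^ l - 1) / l - z ∈ padicBall p 2 := by
  obtain ⟨s, rfl⟩ := Nat.exists_eq_succ_of_ne_zero hl
  have hp : (p : ℚ_[p]) ≠ 0 := by exact_mod_cast hpp.out.ne_zero
  have hl' : ((s + 1 : ℕ) : ℚ_[p]) ≠ 0 := by exact_mod_cast hl
  have key : ((1 + z) ^ (s + 1) - 1) / ((s + 1 : ℕ) : ℚ_[p]) - z =
      ∑ i ∈ Finset.range s, (s.choose (i + 1) : ℚ_[p]) * (z ^ (i + 2) / ((i + 2 : ℕ) : ℚ_[p])) := by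
    have h := add_pow z 1 (s + 1)
    rw [Finset.sum_range_succ', Finset.sum_range_succ'] at h
    rw [add_comm 1 z, h, sub_eq_iff_eq_add, div_eq_iff hl']
    simp only [one_pow, mul_one, Nat.choose_zero_right, pow_zero, Nat.cast_one, add_sub_cancel_right,
      add_mul, Finset.sum_mul, zero_add, pow_one, Nat.choose_one_right]
    congr 1
    refine Finset.sum_congr rfl fun i _ => ?_
    have hc : ((s + 1 : ℕ) : ℚ_[p]) * (s.choose (i + 1) : ℚ_[p]) =
      ((s + 1).choose (i + 2) : ℚ_[p]) * ((i + 2 : ℕ) : ℚ_[p]) := by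
      exact_mod_cast Nat.add_one_mul_choose_eq s (i + 1)
    have hi : ((i + 2 : ℕ) : ℚ_[p]) ≠ 0 := by exact_mod_cast Nat.succ_ne_zero (i + 1)
    rw [show i + 1 + 1 = i + 2 from rfl]
    field_simp
    linear_combination -z ^ (i + 2) * hc
  rw [Nat.succ_eq_add_one, key]
  refine sum_mem fun i _ => mul_left_mem_padicBall (norm_natCast_le_one _) ?_
  have h3 : 3 ≤ p := by
    have := hpp.out.two_le
    rcases this.eq_or_lt with h | h
    · subst h; exact absurd hodd (by decide)
    · exact h
  -- This bounds the valuation of `i + 2` by `i`, so `z^(i+2) / (i + 2)` keeps a factor `p²`. At `i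
  -- = 0` it needs `p > 2`.
  have hlt : i + 2 < p ^ (i + 1) := by
    refine lt_of_lt_of_le ?_ (Nat.pow_le_pow_left h3 (i + 1))
    have := Nat.lt_pow_self (n := i) (show 1 < 3 by norm_num)
    rw [pow_succ]; omega
  have h1 := norm_pow_div_natCast_le_one (p := p) (m := i) (k := i + 2)
    (Nat.not_dvd_of_pos_of_lt (Nat.succ_pos _) hlt)
  rw [mem_padicBall] at hz ⊢
  rw [norm_div, norm_pow, Padic.norm_p] at h1
  rw [norm_div, norm_pow]
  rw [pow_one] at hz
  calc ‖z‖ ^ (i + 2) / ‖((i + 2 : ℕ) : ℚ_[p])‖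
      ≤ (p : ℝ)⁻¹ ^ (i + 2) / ‖((i + 2 : ℕ) : ℚ_[p])‖ := by gcongr
    _ = ((p : ℝ)⁻¹ ^ i / ‖((i + 2 : ℕ) : ℚ_[p])‖) * (p : ℝ)⁻¹ ^ 2 := by ring
    _ ≤ 1 * (p : ℝ)⁻¹ ^ 2 := by gcongr
    _ = _ := one_mul _

end Ball

/-! ### The sums `∑_{k ≤ N} 2^k / k` -/

/-- `∑_{k=1}^N 2^k / k`. -/
def twoPowSum (K : Type*) [Field K] (N : ℕ) : K :=
  ∑ i ∈ Finset.range N, (2 : K) ^ (i + 1) / ((i + 1 : ℕ) : K)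

theorem twoPowSum_succ (K : Type*) [Field K] (N : ℕ) :
    twoPowSum K (N + 1) = twoPowSum K N + 2 ^ (N + 1) / ((N + 1 : ℕ) : K) :=
  Finset.sum_range_succ _ _

theorem twoPowSum_add (K : Type*) [Field K] (M N : ℕ) :
    twoPowSum K (M + N) =
      twoPowSum K M + ∑ i ∈ Finset.range N, (2 : K) ^ (M + i + 1) / ((M + i + 1 : ℕ) : K) :=
  Finset.sum_range_add _ _ _

theorem cast_twoPowSum (K : Type*) [Field K] [CharZero K] (N : ℕ) :
    ((twoPowSum ℚ N : ℚ) : K) = twoPowSum K N := by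
  simp [twoPowSum]

/-! ### Recurrence and closed form for `f` -/

/-- `1 / C(n+1, k) + 1 / C(n+1, k+1) = (n + 2) / (n + 1) * 1 / C(n, k)`. -/
theorem inv_choose_add_inv_choose {n k : ℕ} (hk : k ≤ n) :
    (((n + 1).choose k : ℕ) : ℚ)⁻¹ + (((n + 1).choose (k + 1) : ℕ) : ℚ)⁻¹ =
      (n + 2) / (n + 1) * ((n.choose k : ℕ) : ℚ)⁻¹ := by
  have h1 : ((n : ℚ) + 1) * (n.choose k : ℕ) = ((n + 1).choose (k + 1) : ℕ) * (k + 1) := by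
    exact_mod_cast Nat.add_one_mul_choose_eq n k
  have h2 : ((n.choose k : ℕ) : ℚ) * (n + 1) = ((n + 1).choose k : ℕ) * (n + 1 - k) := by
    have h := Nat.choose_mul_succ_eq n k
    rw [Nat.sub_add_comm hk] at h
    have h' : ((n.choose k * (n + 1) : ℕ) : ℚ) = ((n + 1).choose k * (n - k + 1) : ℕ) := by
      rw [h]
    push_cast [Nat.cast_sub hk] at h'
    linear_combination h'
  have a1 : ((n.choose k : ℕ) : ℚ) ≠ 0 := by exact_mod_cast (Nat.choose_pos hk).ne'
  have a2 : (((n + 1).choose k : ℕ) : ℚ) ≠ 0 := by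
    exact_mod_cast (Nat.choose_pos (hk.trans (Nat.le_succ n))).ne'
  have a3 : (((n + 1).choose (k + 1) : ℕ) : ℚ) ≠ 0 := by
    exact_mod_cast (Nat.choose_pos (Nat.succ_le_succ hk)).ne'
  have a4 : (n : ℚ) + 1 ≠ 0 := by positivity
  have e1 : (((n + 1).choose k : ℕ) : ℚ)⁻¹ = (n + 1 - k) / ((n + 1) * (n.choose k : ℕ)) := by
    field_simp; linear_combination h2
  have e2 : (((n + 1).choose (k + 1) : ℕ) : ℚ)⁻¹ = (k + 1) / ((n + 1) * (n.choose k : ℕ)) := by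
    field_simp; linear_combination h1
  rw [e1, e2]
  field_simp
  ring

/-- Summing the pairing identity over `k ≤ n` produces `f(n+1)` twice, once without its last term
and once without its first, both equal to 1. -/
theorem invBinomSum_succ (n : ℕ) :
    invBinomSum (n + 1) = (n + 2) / (2 * (n + 1)) * invBinomSum n + 1 := by
  have h1 : invBinomSum (n + 1) =
      ∑ k ∈ Finset.range (n + 1), (((n + 1).choose k : ℕ) : ℚ)⁻¹ + 1 := by
    rw [invBinomSum, Finset.sum_range_succ]; simp
  have h2 : invBinomSum (n + 1) =
      ∑ k ∈ Finset.range (n + 1), (((n + 1).choose (k + 1) : ℕ) : ℚ)⁻¹ + 1 := by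
    rw [invBinomSum, Finset.sum_range_succ']; simp
  have h3 : ∑ k ∈ Finset.range (n + 1), (((n + 1).choose k : ℕ) : ℚ)⁻¹ +
      ∑ k ∈ Finset.range (n + 1), (((n + 1).choose (k + 1) : ℕ) : ℚ)⁻¹ =
      (n + 2) / (n + 1) * invBinomSum n := by
    rw [← Finset.sum_add_distrib, invBinomSum, Finset.mul_sum]
    exact Finset.sum_congr rfl fun k hk =>
      inv_choose_add_inv_choose (Nat.lt_succ_iff.1 (Finset.mem_range.1 hk))
  have h4 : ((n : ℚ) + 2) / (2 * (n + 1)) = (n + 2) / (n + 1) / 2 := by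
    rw [div_div, mul_comm]
  rw [h4]
  linear_combination h1 / 2 + h2 / 2 + h3 / 2

/-- `f(n) = (n + 1) / 2^(n + 1) * ∑_{k=1}^{n+1} 2^k / k`. -/
theorem invBinomSum_eq (n : ℕ) :
    invBinomSum n = (n + 1) / 2 ^ (n + 1) * twoPowSum ℚ (n + 1) := by
  induction n with
  | zero => simp [invBinomSum, twoPowSum]
  | succ n ih =>
    have h : (n : ℚ) + 1 ≠ 0 := by positivity
    have h' : (n : ℚ) + 2 ≠ 0 := by positivity
    rw [invBinomSum_succ, ih, twoPowSum_succ ℚ (n + 1)]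
    push_cast
    rw [show (n : ℚ) + 1 + 1 = n + 2 by ring]
    field_simp
    ring

/-! ### Congruences for `T(pM)` and `T(p^n M)` -/

section Padic

variable {p : ℕ} [hpp : Fact p.Prime]

theorem cast_invBinomSum (n : ℕ) :
    ((invBinomSum n : ℚ) : ℚ_[p]) =
      ((n + 1 : ℕ) : ℚ_[p]) / 2 ^ (n + 1) * twoPowSum ℚ_[p] (n + 1) := by
  rw [invBinomSum_eq, ← cast_twoPowSum ℚ_[p], Rat.cast_mul]
  push_cast
  rfl

theorem two_pow_div_sub_mem (hodd : Odd p) (M : ℕ) {a : ℕ} (ha : ¬ p ∣ a) :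
    (2 : ℚ_[p]) ^ (p * M + a) / ((p * M + a : ℕ) : ℚ_[p]) - 2 ^ M * (2 ^ a / (a : ℚ_[p]))
      ∈ padicBall p 1 := by
  have ha' : ¬ p ∣ p * M + a := by rwa [Nat.dvd_add_right (dvd_mul_right p M)]
  have n1 := norm_natCast_eq_one_of_not_dvd ha
  have n2 := norm_natCast_eq_one_of_not_dvd ha'
  have z1 : (a : ℚ_[p]) ≠ 0 := norm_ne_zero_iff.1 (by rw [n1]; exact one_ne_zero)
  have z2 : ((p * M + a : ℕ) : ℚ_[p]) ≠ 0 := norm_ne_zero_iff.1 (by rw [n2]; exact one_ne_zero)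
  have h1 := mul_left_mem_padicBall (norm_natCast_le_one a)
    (mul_left_mem_padicBall (norm_two_pow_eq_one hodd a).le (two_pow_prime_mul_sub_mem (p := p) M))
  have h2 := mul_left_mem_padicBall (norm_natCast_le_one M)
    (mul_left_mem_padicBall (norm_two_pow_eq_one hodd (M + a)).le (prime_mem_padicBall (p := p)))
  convert div_mem_padicBall n1 (div_mem_padicBall n2 (sub_mem h1 h2)) using 1
  field_simp
  push_cast
  ring

/-- `p T(pM) ≡ T(M)` modulo `p²`, where `T(N) = ∑_{k ≤ N} 2^k / k`. -/
theorem prime_mul_twoPowSum_sub_mem (hodd : Odd p) (M : ℕ) :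
    (p : ℚ_[p]) * twoPowSum ℚ_[p] (p * M) - twoPowSum ℚ_[p] M ∈ padicBall p 2 := by
  have hp : (p : ℚ_[p]) ≠ 0 := by exact_mod_cast hpp.out.ne_zero
  induction M with
  | zero => simp [twoPowSum, zero_mem]
  | succ M ih =>
    have hM : ((M + 1 : ℕ) : ℚ_[p]) ≠ 0 := by exact_mod_cast Nat.succ_ne_zero M
    have h1 : (p : ℚ_[p]) * ∑ i ∈ Finset.range (p - 1),
        ((2 : ℚ_[p]) ^ (p * M + (i + 1)) / ((p * M + (i + 1) : ℕ) : ℚ_[p]) -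
          2 ^ M * (2 ^ (i + 1) / ((i + 1 : ℕ) : ℚ_[p]))) ∈ padicBall p 2 := by
      refine mul_mem_padicBall (j := 1) (k := 1) prime_mem_padicBall (sum_mem fun i hi => ?_)
      have hi' : i + 1 < p := by have := Finset.mem_range.1 hi; omega
      exact two_pow_div_sub_mem hodd M (Nat.not_dvd_of_pos_of_lt (Nat.succ_pos _) hi')
    have hz : (2 : ℚ_[p]) ^ (p - 1) - 1 ∈ padicBall p 1 := by
      have h := two_pow_prime_mul_sub_mem (p := p) 1
      refine mem_padicBall_of_mul (norm_two_eq_one hodd) ?_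
      convert h using 1
      rw [mul_one, pow_one, mul_sub, ← pow_succ', Nat.sub_add_cancel hpp.out.one_le, mul_one]
    -- The index `p(M+1)` contributes `2^(M+1) (2^(p-1) - 1)` mod `p²` after comparison with the
    -- last term of `T(M+1)`, even when `p` divides `M + 1`. The other indices of the block
    -- contribute `-2^M (2^p - 2)`, which cancels it.
    have h2 := mul_left_mem_padicBall (norm_two_pow_eq_one hodd (M + 1)).le
      (one_add_pow_sub_one_div_sub_mem hodd hz (M + 1) (Nat.succ_ne_zero M))
    have h3 := mul_left_mem_padicBall (norm_two_pow_eq_one hodd M).le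
      (sum_two_pow_div_add_mem (p := p) hodd)
    convert add_mem ih (add_mem h1 (add_mem h2 h3)) using 1
    have e1 : twoPowSum ℚ_[p] (p * (M + 1)) = twoPowSum ℚ_[p] (p * M) +
        (∑ i ∈ Finset.range (p - 1),
          (2 : ℚ_[p]) ^ (p * M + (i + 1)) / ((p * M + (i + 1) : ℕ) : ℚ_[p]) +
          2 ^ (p * (M + 1)) / ((p * (M + 1) : ℕ) : ℚ_[p])) := by
      rw [mul_add, mul_one, twoPowSum_add]
      congr 1
      conv_lhs => rw [show Finset.range p = Finset.range (p - 1 + 1) by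
        rw [Nat.sub_add_cancel hpp.out.one_le]]
      rw [Finset.sum_range_succ, add_assoc, Nat.sub_add_cancel hpp.out.one_le]
      rfl
    have e2 : (1 + ((2 : ℚ_[p]) ^ (p - 1) - 1)) ^ (M + 1) = 2 ^ (p * (M + 1)) / 2 ^ (M + 1) := by
      rw [eq_div_iff (pow_ne_zero _ two_ne_zero), add_sub_cancel, ← mul_pow, ← pow_succ,
        Nat.sub_add_cancel hpp.out.one_le, pow_mul]
    have e3 : (2 : ℚ_[p]) ^ p = 2 * 2 ^ (p - 1) := by
      rw [← pow_succ', Nat.sub_add_cancel hpp.out.one_le]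
    rw [e1, e2, e3, twoPowSum_succ, Finset.sum_sub_distrib, ← Finset.mul_sum, Nat.cast_mul]
    field_simp
    ring

theorem pow_mul_twoPowSum_succ_sub_mem (hodd : Odd p) (n M : ℕ) :
    (p : ℚ_[p]) ^ (n + 1) * twoPowSum ℚ_[p] (p ^ (n + 1) * M) -
      (p : ℚ_[p]) ^ n * twoPowSum ℚ_[p] (p ^ n * M) ∈ padicBall p (n + 2) := by
  convert mul_mem_padicBall (pow_mem_padicBall n)
    (prime_mul_twoPowSum_sub_mem (p := p) hodd (p ^ n * M)) using 1
  rw [pow_succ' p n, mul_assoc]; ring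

/-- The level steps telescope, and the lowest one limits the precision: `m = 0` is used modulo `p²`,
`m = 1` modulo `p³`. -/
theorem pow_mul_twoPowSum_sub_mem (hodd : Odd p) {m n : ℕ} (hmn : m ≤ n) (M : ℕ) :
    (p : ℚ_[p]) ^ n * twoPowSum ℚ_[p] (p ^ n * M) -
      (p : ℚ_[p]) ^ m * twoPowSum ℚ_[p] (p ^ m * M) ∈ padicBall p (m + 2) := by
  induction n, hmn using Nat.le_induction with
  | base => simp [zero_mem]
  | succ n hn ih =>
    have := padicBall_anti (show m + 2 ≤ n + 2 by omega) (pow_mul_twoPowSum_succ_sub_mem hodd n M)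
    simpa using add_mem this ih

/-! ### Splitting off the leading digit -/

/-- The correction `∑_{k ≤ N} 2^k p^{2n} / (k (k + c p^n))` in the expansion of
`p^n T(c p^n + N)`. -/
noncomputable def twoPowCorrection (p : ℕ) [Fact p.Prime] (c n N : ℕ) : ℚ_[p] :=
  ∑ i ∈ Finset.range N, (2 : ℚ_[p]) ^ (i + 1) *
    ((p : ℚ_[p]) ^ n / ((i + 1 : ℕ) : ℚ_[p]) * (p ^ n / ((i + 1 + p ^ n * c : ℕ) : ℚ_[p])))

/-- Termwise, with `q = p^n`, this is `1/(k + cq) = 1/k - cq/(k(k + cq))`. -/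
theorem pow_mul_twoPowSum_add (c n N : ℕ) :
    (p : ℚ_[p]) ^ n * twoPowSum ℚ_[p] (p ^ n * c + N) =
      p ^ n * twoPowSum ℚ_[p] (p ^ n * c) +
        2 ^ (p ^ n * c) * (p ^ n * twoPowSum ℚ_[p] N - c * twoPowCorrection p c n N) := by
  rw [twoPowSum_add, mul_add, add_right_inj, twoPowSum, twoPowCorrection]
  simp only [Finset.mul_sum, ← Finset.sum_sub_distrib]
  refine Finset.sum_congr rfl fun i _ => ?_
  have h1 : ((i + 1 : ℕ) : ℚ_[p]) ≠ 0 := by exact_mod_cast Nat.succ_ne_zero i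
  have h2 : ((i + 1 + p ^ n * c : ℕ) : ℚ_[p]) ≠ 0 := by exact_mod_cast (by omega)
  rw [show p ^ n * c + i + 1 = i + 1 + p ^ n * c by ring]
  field_simp
  push_cast
  ring

/-- Both `k` and `k + c p^n` have valuation at most `m`, so each quotient contributes a factor
`p^(j+1)`. -/
theorem correction_term_mem (hodd : Odd p) {c n j m k : ℕ} (hm : m + 1 + j = n)
    (hk : ¬ p ^ (m + 1) ∣ k) :
    (2 : ℚ_[p]) ^ k * ((p : ℚ_[p]) ^ n / (k : ℚ_[p]) * (p ^ n / ((k + p ^ n * c : ℕ) : ℚ_[p])))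
      ∈ padicBall p (2 * j + 2) := by
  have hk' : ¬ p ^ (m + 1) ∣ k + p ^ n * c := by
    rwa [Nat.dvd_add_left (Dvd.dvd.mul_right (pow_dvd_pow p (by omega)) c)]
  refine mul_left_mem_padicBall (norm_two_pow_eq_one hodd k).le ?_
  have key : ∀ l : ℕ, ¬ p ^ (m + 1) ∣ l → (p : ℚ_[p]) ^ n / (l : ℚ_[p]) ∈ padicBall p (j + 1) := by
    intro l hl
    convert mul_left_mem_padicBall (norm_pow_div_natCast_le_one hl)
      (pow_mem_padicBall (p := p) (j + 1)) using 1
    rw [← hm]; ring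
  convert mul_mem_padicBall (key _ hk) (key _ hk') using 1
  ring_nf

theorem twoPowCorrection_mem (hodd : Odd p) {c n N : ℕ} (hN : N < p ^ n) :
    twoPowCorrection p c n N ∈ padicBall p 2 := by
  rcases n with _ | n
  · have : N = 0 := by simpa using hN
    subst this
    simp [twoPowCorrection, zero_mem]
  refine sum_mem fun i hi => ?_
  have := Finset.mem_range.1 hi
  exact correction_term_mem hodd (j := 0) (m := n) rfl
    (Nat.not_dvd_of_pos_of_lt (Nat.succ_pos _) (by omega))

/-- Modulo `p³` only the multiples of `p^n` contribute to the correction at level `n + 1`. -/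
theorem twoPowCorrection_sub_mem (hodd : Odd p) {c n e r : ℕ} (hn : n ≠ 0) (he : e < p)
    (hr : r < p ^ n) :
    twoPowCorrection p c (n + 1) (p ^ n * e + r) -
      p ^ 2 * ∑ j ∈ Finset.range e, (2 : ℚ_[p]) ^ (j + 1) / ((j + 1 : ℕ) : ℚ_[p]) ^ 2
      ∈ padicBall p 3 := by
  obtain ⟨m, rfl⟩ := Nat.exists_eq_succ_of_ne_zero hn
  have hpos : 0 < p ^ (m + 1) := pow_pos hpp.out.pos _
  have hp : (p : ℚ_[p]) ≠ 0 := by exact_mod_cast hpp.out.ne_zero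
  -- Indices strictly between multiples of `p^(m+1)` give terms divisible by `p⁴`.
  have hblock : ∀ M s : ℕ, p ^ (m + 1) ∣ M → s < p ^ (m + 1) →
      twoPowCorrection p c (m + 2) (M + s) - twoPowCorrection p c (m + 2) M ∈ padicBall p 3 := by
    intro M s hM hs
    rw [twoPowCorrection, Finset.sum_range_add, ← twoPowCorrection, add_sub_cancel_left]
    refine sum_mem fun i hi => ?_
    have hi := Finset.mem_range.1 hi
    refine padicBall_anti (show 3 ≤ 2 * 1 + 2 by norm_num)
      (correction_term_mem hodd (j := 1) (m := m) rfl ?_)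
    rw [add_assoc, Nat.dvd_add_right hM]
    exact Nat.not_dvd_of_pos_of_lt (Nat.succ_pos _) (by omega)
  have hmul : twoPowCorrection p c (m + 2) (p ^ (m + 1) * e) -
      p ^ 2 * ∑ j ∈ Finset.range e, (2 : ℚ_[p]) ^ (j + 1) / ((j + 1 : ℕ) : ℚ_[p]) ^ 2
      ∈ padicBall p 3 := by
    clear hr
    induction e with
    | zero => simp [twoPowCorrection, zero_mem]
    | succ e ih =>
      have h1 := hblock (p ^ (m + 1) * e) (p ^ (m + 1) - 1) (dvd_mul_right _ _) (by omega)
      have e1 : p ^ (m + 1) * (e + 1) = p ^ (m + 1) * e + (p ^ (m + 1) - 1) + 1 := by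
        rw [mul_add, mul_one]; omega
      have e2 : twoPowCorrection p c (m + 2) (p ^ (m + 1) * (e + 1)) =
          twoPowCorrection p c (m + 2) (p ^ (m + 1) * e + (p ^ (m + 1) - 1)) +
          2 ^ (p ^ (m + 1) * (e + 1)) * ((p : ℚ_[p]) ^ (m + 2) / ((p ^ (m + 1) * (e + 1) : ℕ) : ℚ_[p])
            * (p ^ (m + 2) / ((p ^ (m + 1) * (e + 1) + p ^ (m + 2) * c : ℕ) : ℚ_[p]))) := by
        rw [e1, twoPowCorrection, Finset.sum_range_succ, ← twoPowCorrection]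
      have u1 : ¬ p ∣ e + 1 := Nat.not_dvd_of_pos_of_lt (Nat.succ_pos _) he
      have u2 : ¬ p ∣ e + 1 + p * c := by rwa [Nat.dvd_add_left (dvd_mul_right p c)]
      have n1 := norm_natCast_eq_one_of_not_dvd u1
      have n2 := norm_natCast_eq_one_of_not_dvd u2
      have z1 : ((e + 1 : ℕ) : ℚ_[p]) ≠ 0 := norm_ne_zero_iff.1 (by rw [n1]; exact one_ne_zero)
      have z2 : ((e + 1 + p * c : ℕ) : ℚ_[p]) ≠ 0 :=
        norm_ne_zero_iff.1 (by rw [n2]; exact one_ne_zero)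
      -- After `p²` is extracted, the term at `p^(m+1)(e+1)` matters only modulo `p`: Fermat reduces
      -- the power of 2, and `e + 1 + pc` reduces to `e + 1`.
      have t1 := mul_left_mem_padicBall (norm_natCast_le_one (e + 1))
        (two_pow_pow_mul_sub_mem (p := p) (m + 1) (e + 1))
      have t2 := mul_left_mem_padicBall (norm_natCast_le_one c)
        (mul_left_mem_padicBall (norm_two_pow_eq_one hodd (e + 1)).le
          (prime_mem_padicBall (p := p)))
      have t3 := mul_mem_padicBall (pow_mem_padicBall (p := p) 2)
        (div_mem_padicBall n1 (div_mem_padicBall n1 (div_mem_padicBall n2 (sub_mem t1 t2))))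
      have e3 : (((p ^ (m + 1) * (e + 1) : ℕ)) : ℚ_[p]) = p ^ (m + 1) * ((e + 1 : ℕ) : ℚ_[p]) := by
        push_cast; ring
      have e4 : (((p ^ (m + 1) * (e + 1) + p ^ (m + 2) * c : ℕ)) : ℚ_[p]) =
          p ^ (m + 1) * ((e + 1 + p * c : ℕ) : ℚ_[p]) := by
        push_cast; ring
      convert add_mem (add_mem (ih (by omega)) h1) t3 using 1
      rw [e2, e3, e4, Finset.sum_range_succ]
      have e5 : ((e + 1 + p * c : ℕ) : ℚ_[p]) = ((e + 1 : ℕ) : ℚ_[p]) + p * c := by push_cast; ring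
      field_simp
      rw [e5]
      ring
  simpa using add_mem (hblock (p ^ (m + 1) * e) r (dvd_mul_right _ _) hr) hmul

end Padic

section Definable

variable {p : ℕ} [hpp : Fact p.Prime]

/-! ### Partial sums of a `p`-adic integer -/

theorem appr_succ_eq (x : ℤ_[p]) (n : ℕ) :
    x.appr (n + 1) = p ^ n * padicDigit x n + x.appr n := by
  rcases n with _ | n
  · simp [padicDigit, PadicInt.appr]
  · rw [← padicPartialSum_eq_appr x (n + 1), padicPartialSum, Finset.sum_range_succ,
      ← padicPartialSum, padicPartialSum_eq_appr]
    ring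

theorem sub_appr_mem (x : ℤ_[p]) (n : ℕ) :
    (x : ℚ_[p]) - (x.appr n : ℕ) ∈ padicBall p n := by
  have h := (PadicInt.norm_le_pow_iff_mem_span_pow _ n).2 (x.appr_spec n)
  rw [zpow_neg, zpow_natCast, ← inv_pow] at h
  rw [mem_padicBall]
  rw [PadicInt.norm_def] at h
  simpa using h

theorem exists_padicDigit_ne_zero (x : ℤ_[p]) (hx : ∀ n : ℕ, x ≠ (n : ℤ_[p])) (n₀ : ℕ) :
    ∃ n, n₀ ≤ n ∧ padicDigit x n ≠ 0 := by
  by_contra! h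
  have hconst : ∀ n, n₀ ≤ n → x.appr n = x.appr n₀ := by
    intro n hn
    induction n, hn using Nat.le_induction with
    | base => rfl
    | succ n hn ih => rw [appr_succ_eq, h n hn, mul_zero, zero_add, ih]
  refine hx (x.appr n₀) (tendsto_nhds_unique (tendsto_padicPartialSum x) ?_)
  refine tendsto_const_nhds.congr' ?_
  filter_upwards [eventually_ge_atTop n₀] with n hn
  rw [padicPartialSum_eq_appr, hconst (n + 1) (by omega)]

theorem tendsto_inv_prime_pow : Tendsto (fun n : ℕ => ((p : ℝ)⁻¹) ^ n) atTop (𝓝 0) := by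
  have hp : (1 : ℝ) < p := by exact_mod_cast hpp.out.one_lt
  exact tendsto_pow_atTop_nhds_zero_of_lt_one (by positivity) (inv_lt_one_of_one_lt₀ hp)

/-- Once `p^(-n) < ‖x + 1‖`, the ultrametric inequality fixes the norm; equality `x.appr n + 1 =
p^n` would make it too small. -/
theorem eventually_norm_appr_add_one {x : ℤ_[p]} (hx : x ≠ -1) :
    ∀ᶠ n : ℕ in atTop, x.appr n + 1 < p ^ n ∧
      ‖((x.appr n + 1 : ℕ) : ℚ_[p])‖ = ‖(x : ℚ_[p]) + 1‖ := by
  have h0 : (x : ℚ_[p]) + 1 ≠ 0 := by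
    intro h
    apply hx
    have : ((x + 1 : ℤ_[p]) : ℚ_[p]) = 0 := by push_cast; exact h
    exact eq_neg_of_add_eq_zero_left (PadicInt.coe_eq_zero.1 this)
  filter_upwards [(tendsto_inv_prime_pow (p := p)).eventually_lt_const (norm_pos_iff.2 h0)]
    with n hn
  have h1 : ‖(x : ℚ_[p]) + 1 - ((x.appr n + 1 : ℕ) : ℚ_[p])‖ < ‖(x : ℚ_[p]) + 1‖ := by
    refine lt_of_le_of_lt ?_ hn
    have := sub_appr_mem x n
    rw [mem_padicBall] at this
    push_cast
    rwa [add_sub_add_right_eq_sub]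
  have h2 : ‖((x.appr n + 1 : ℕ) : ℚ_[p])‖ = ‖(x : ℚ_[p]) + 1‖ := by
    rw [norm_sub_rev] at h1
    exact Padic.norm_eq_of_norm_sub_lt_right h1
  refine ⟨lt_of_le_of_ne (x.appr_lt n) fun h => ?_, h2⟩
  rw [h, Nat.cast_pow, norm_pow, Padic.norm_p] at h2
  exact hn.ne h2

theorem eventually_pow_mul_twoPowSum_mem (hodd : Odd p) {x : ℤ_[p]} (hx : x ≠ -1)
    (h : IsPDefinable x) (k : ℕ) : ∀ᶠ n : ℕ in atTop, x.appr n + 1 < p ^ n ∧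
      (p : ℚ_[p]) ^ n * twoPowSum ℚ_[p] (x.appr n + 1) ∈ padicBall p k := by
  obtain ⟨L, hL⟩ := h
  simp only [padicPartialSum_eq_appr] at hL
  have hL' := (tendsto_add_atTop_iff_nat
    (f := fun n => ((invBinomSum (x.appr n) : ℚ) : ℚ_[p])) 1).1 hL
  have h1 : Tendsto (fun n : ℕ => ((p : ℝ)⁻¹) ^ n *
      (‖((invBinomSum (x.appr n) : ℚ) : ℚ_[p])‖ / ‖(x : ℚ_[p]) + 1‖)) atTop (𝓝 0) := by
    have := (tendsto_inv_prime_pow (p := p)).mul (hL'.norm.div_const ‖(x : ℚ_[p]) + 1‖)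
    rwa [zero_mul] at this
  have hpos : (0 : ℝ) < (p : ℝ)⁻¹ ^ k := by
    have : (0 : ℝ) < p := by exact_mod_cast hpp.out.pos
    positivity
  filter_upwards [eventually_norm_appr_add_one hx, h1.eventually_lt_const hpos] with n hn hn'
  refine ⟨hn.1, ?_⟩
  have hne : ‖(x : ℚ_[p]) + 1‖ ≠ 0 := by
    rw [← hn.2, norm_ne_zero_iff]
    exact Nat.cast_ne_zero.2 (Nat.succ_ne_zero _)
  rw [mem_padicBall, norm_mul, norm_pow, Padic.norm_p]
  rw [cast_invBinomSum, norm_mul, norm_div, norm_two_pow_eq_one hodd, hn.2, div_one,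
    mul_div_cancel_left₀ _ hne] at hn'
  exact hn'.le

theorem prime_pow_mul_appr_succ_mem {x : ℤ_[p]} {n k : ℕ}
    (h : (p : ℚ_[p]) ^ (n + 1) * twoPowSum ℚ_[p] (x.appr (n + 1) + 1) ∈ padicBall p (k + 1)) :
    (p : ℚ_[p]) ^ n * twoPowSum ℚ_[p] (p ^ n * padicDigit x n + (x.appr n + 1))
      ∈ padicBall p k := by
  refine mem_padicBall_of_prime_mul ?_
  rwa [← add_assoc, ← appr_succ_eq, ← mul_assoc, ← pow_succ']

/-- The digits of a point of definability satisfy `T(ε) ≡ 0` modulo `p²`. -/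
theorem eventually_twoPowSum_padicDigit_mem (hodd : Odd p) {x : ℤ_[p]} (hx : x ≠ -1)
    (h : IsPDefinable x) :
    ∀ᶠ n : ℕ in atTop, twoPowSum ℚ_[p] (padicDigit x n) ∈ padicBall p 2 := by
  -- One power of `p` is lost in replacing `p^(n+1)` by `p^n`, so 3 yields a congruence modulo `p²`.
  have ev := eventually_pow_mul_twoPowSum_mem hodd hx h 3
  filter_upwards [ev, (tendsto_add_atTop_nat 1).eventually ev] with n h1 h2
  have h3 := prime_pow_mul_appr_succ_mem h2.2
  rw [pow_mul_twoPowSum_add] at h3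
  have h4 := mul_left_mem_padicBall (norm_two_pow_eq_one hodd (p ^ n * padicDigit x n)).le
    (sub_mem (padicBall_anti (show 2 ≤ 3 by norm_num) h1.2)
      (mul_left_mem_padicBall (norm_natCast_le_one (padicDigit x n))
        (twoPowCorrection_mem hodd (c := padicDigit x n) h1.1)))
  have h5 := pow_mul_twoPowSum_sub_mem (p := p) hodd (Nat.zero_le n) (padicDigit x n)
  convert sub_mem (sub_mem h3 h4) h5 using 1
  simp

/-- The congruence modulo `p³` satisfied by two consecutive digits of a point of definability. -/
theorem eventually_consecutive_padicDigit_mem (hodd : Odd p) {x : ℤ_[p]} (hx : x ≠ -1)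
    (h : IsPDefinable x) :
    ∀ᶠ n : ℕ in atTop,
      p * twoPowSum ℚ_[p] (p * padicDigit x (n + 1)) -
        2 ^ padicDigit x (n + 1) * (padicDigit x (n + 1) * (p ^ 2 *
          ∑ j ∈ Finset.range (padicDigit x n), (2 : ℚ_[p]) ^ (j + 1) / ((j + 1 : ℕ) : ℚ_[p]) ^ 2))
        ∈ padicBall p 3 := by
  have ev := eventually_pow_mul_twoPowSum_mem hodd hx h 4
  filter_upwards [ev, (tendsto_add_atTop_nat 1).eventually ev,
    (tendsto_add_atTop_nat 2).eventually ev, eventually_ne_atTop 0] with n h0 h1 h2 hn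
  have h3 := prime_pow_mul_appr_succ_mem (k := 3) h2.2
  set c := padicDigit x (n + 1) with hc
  rw [pow_mul_twoPowSum_add] at h3
  have ha : x.appr (n + 1) + 1 = p ^ n * padicDigit x n + (x.appr n + 1) := by
    rw [appr_succ_eq, add_assoc]
  have hcorr := twoPowCorrection_sub_mem hodd (c := c) hn (padicDigit_lt x n) h0.1
  rw [← ha] at hcorr
  have hmem := twoPowCorrection_mem hodd (c := c) h1.1
  -- Fermat modulo `p` suffices, since the correction it multiplies already lies in `p²`.
  have hfer := two_pow_pow_mul_sub_mem (p := p) (n + 1) c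
  have hT := pow_mul_twoPowSum_sub_mem (p := p) hodd (show 1 ≤ n + 1 by omega) c
  have a1 := mul_left_mem_padicBall (norm_two_pow_eq_one hodd (p ^ (n + 1) * c)).le
    (padicBall_anti (show 3 ≤ 4 by norm_num) h1.2)
  have a2 := mul_left_mem_padicBall (norm_natCast_le_one c) (mul_mem_padicBall hfer hmem)
  have a3 := mul_left_mem_padicBall (norm_natCast_le_one c)
    (mul_left_mem_padicBall (norm_two_pow_eq_one hodd c).le hcorr)
  convert add_mem (add_mem (sub_mem (sub_mem h3 a1) hT) a2) a3 using 1
  simp only [pow_one]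
  ring

/-! ### Good primes -/

theorem not_mem_padicBall_of_lt {k : ℕ} {x : ℚ_[p]} (h : (p : ℝ)⁻¹ ^ k < ‖x‖) :
    x ∉ padicBall p k := fun hx => absurd (mem_padicBall.1 hx) (not_le.2 h)

/-- Since `f(c-1) = c / 2^c * T(c)`, membership would give `ν_p(f(c-1)) ≥ 2`. The digit `c = 1` lies
outside the range of goodness, but `T(1) = 2` is a unit. -/
theorem IsGood.twoPowSum_notMem (hodd : Odd p) (hg : IsGood p) {c : ℕ} (hc : c ≠ 0) (hcp : c < p) :
    twoPowSum ℚ_[p] c ∉ padicBall p 2 := by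
  have hp : (1 : ℝ) < p := by exact_mod_cast hpp.out.one_lt
  have hinv : (p : ℝ)⁻¹ < 1 := inv_lt_one_of_one_lt₀ hp
  have hinv0 : (0 : ℝ) < (p : ℝ)⁻¹ := by positivity
  obtain ⟨n, rfl⟩ := Nat.exists_eq_succ_of_ne_zero hc
  rcases Nat.eq_zero_or_pos n with rfl | hn
  · apply not_mem_padicBall_of_lt
    simp only [twoPowSum, Nat.succ_eq_add_one, zero_add, Finset.range_one, Finset.sum_singleton,
      pow_one, Nat.cast_one, div_one, norm_two_eq_one hodd]
    nlinarith
  · intro hT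
    have hf : ((invBinomSum n : ℚ) : ℚ_[p]) ∈ padicBall p 2 := by
      rw [cast_invBinomSum]
      refine mul_left_mem_padicBall ?_ hT
      rw [norm_div, norm_two_pow_eq_one hodd, div_one]
      exact norm_natCast_le_one _
    have hpos : invBinomSum n ≠ 0 := by
      refine (Finset.sum_pos (fun k hk => ?_) ⟨0, by simp⟩).ne'
      have := Nat.choose_pos (Nat.lt_succ_iff.1 (Finset.mem_range.1 hk))
      positivity
    rw [mem_padicBall, Padic.eq_padicNorm, padicNorm.eq_zpow_of_nonzero hpos] at hf
    push_cast at hf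
    rw [inv_pow, ← zpow_natCast, ← zpow_neg, zpow_le_zpow_iff_right₀ hp] at hf
    have := hg n hn (by omega)
    push_cast at hf
    omega

end Definable

/-! ### The prime `23` -/

/-- The integer `N! * ∑_{k=1}^N 2^k / k`. -/
def twoPowNumerator : ℕ → ℕ
  | 0 => 0
  | n + 1 => (n + 1) * twoPowNumerator n + 2 ^ (n + 1) * n.factorial

theorem factorial_mul_twoPowSum (K : Type*) [Field K] [CharZero K] (N : ℕ) :
    (N.factorial : K) * twoPowSum K N = twoPowNumerator N := by
  induction N with
  | zero => simp [twoPowSum, twoPowNumerator]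
  | succ n ih =>
    have : ((n + 1 : ℕ) : K) ≠ 0 := Nat.cast_ne_zero.2 (Nat.succ_ne_zero n)
    rw [twoPowSum_succ, twoPowNumerator, Nat.factorial_succ]
    push_cast at this ⊢
    rw [← ih]
    field_simp

theorem natCast_mem_padicBall {p : ℕ} [Fact p.Prime] {k n : ℕ} :
    (n : ℚ_[p]) ∈ padicBall p k ↔ p ^ k ∣ n := by
  have := intCast_mem_padicBall (p := p) (k := k) (z := n)
  rw [Int.cast_natCast] at this
  rw [this]
  exact_mod_cast Iff.rfl

section TwentyThree

theorem odd_twentyThree : Odd 23 := by decide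

variable [Fact (Nat.Prime 23)]

theorem eq_thirteen_of_twoPowSum_mem {c : ℕ} (hc : c < 23)
    (h : twoPowSum ℚ_[23] c ∈ padicBall 23 2) : c = 0 ∨ c = 13 := by
  have h1 := mul_left_mem_padicBall (norm_natCast_le_one c.factorial) h
  rw [factorial_mul_twoPowSum, natCast_mem_padicBall] at h1
  have key : ∀ c < 23, 23 ^ 2 ∣ twoPowNumerator c → c = 0 ∨ c = 13 := by decide +kernel
  exact key c hc h1

theorem twoPowSum_twentyThree_mul_thirteen :
    ((23 : ℕ) : ℚ_[23]) * twoPowSum ℚ_[23] (23 * 13) - (23 : ℕ) ^ 2 * 22 ∈ padicBall 23 3 := by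
  have hfac : Nat.factorial 299 = 23 ^ 13 * (Nat.factorial 299 / 23 ^ 13) := by decide +kernel
  have hu : ¬ 23 ∣ Nat.factorial 299 / 23 ^ 13 := by decide +kernel
  -- The exponent is `16 = 13 + 3`: clearing denominators by `299!`, of 23-adic valuation 13, turns
  -- a congruence modulo `23³` into one modulo `23^16`.
  have hmod : ((23 ^ 16 : ℕ) : ℤ) ∣
      ((23 * twoPowNumerator 299 : ℕ) : ℤ) - ((23 ^ 2 * 22 * Nat.factorial 299 : ℕ) : ℤ) := by
    refine (Nat.modEq_iff_dvd.1 ?_)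
    show _ % _ = _ % _
    decide +kernel
  rw [Nat.cast_pow] at hmod
  have h1 := (intCast_mem_padicBall (p := 23) (k := 16)).2 hmod
  refine mem_padicBall_of_mul (norm_natCast_eq_one_of_not_dvd hu) ?_
  have h2 : ∀ j : ℕ, ∀ y : ℚ_[23], ((23 : ℕ) : ℚ_[23]) ^ j * y ∈ padicBall 23 (j + 3) →
      y ∈ padicBall 23 3 := by
    intro j
    induction j with
    | zero => intro y hy; simpa using hy
    | succ j ih =>
      intro y hy
      refine ih y (mem_padicBall_of_prime_mul ?_)
      rw [← mul_assoc, ← pow_succ']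
      convert hy using 2
  refine h2 13 _ ?_
  convert h1 using 1
  have h3 := factorial_mul_twoPowSum ℚ_[23] 299
  have h4 : (Nat.factorial 299 : ℚ_[23]) =
      ((23 : ℕ) : ℚ_[23]) ^ 13 * ((Nat.factorial 299 / 23 ^ 13 : ℕ) : ℚ_[23]) := by
    exact_mod_cast congrArg (Nat.cast (R := ℚ_[23])) hfac
  rw [← mul_assoc, ← h4, Int.cast_sub, Int.cast_natCast, Int.cast_natCast, Nat.cast_mul, ← h3,
    Nat.cast_mul]
  rw [show 23 * 13 = 299 from rfl]
  generalize (Nat.factorial 299 : ℚ_[23]) = F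
  generalize twoPowSum ℚ_[23] 299 = t
  push_cast
  ring

theorem not_isPDefinable_twentyThree {x : ℤ_[23]} (hx : x ≠ -1)
    (hx' : ∀ n : ℕ, x ≠ (n : ℤ_[23])) : ¬ IsPDefinable x := by
  intro h
  have ev1 := eventually_twoPowSum_padicDigit_mem odd_twentyThree hx h
  have ev2 := eventually_consecutive_padicDigit_mem odd_twentyThree hx h
  obtain ⟨n₀, hn₀⟩ := eventually_atTop.1 (ev1.and ev2)
  -- The shift to `n₀ + 1` keeps the preceding digit in the range where both congruences hold.
  obtain ⟨m, hm, hd⟩ := exists_padicDigit_ne_zero x hx' (n₀ + 1)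
  obtain ⟨n, rfl⟩ : ∃ n, m = n + 1 := ⟨m - 1, by omega⟩
  have hc : padicDigit x (n + 1) = 13 :=
    (eq_thirteen_of_twoPowSum_mem (padicDigit_lt x _) (hn₀ (n + 1) (by omega)).1).resolve_left hd
  have he := eq_thirteen_of_twoPowSum_mem (padicDigit_lt x _) (hn₀ n (by omega)).1
  have h3 := (hn₀ n (by omega)).2
  rw [hc] at h3
  have h4 := sub_mem h3 twoPowSum_twentyThree_mul_thirteen
  have h5 : ∀ y : ℚ_[23], ((23 : ℕ) : ℚ_[23]) ^ 2 * y ∈ padicBall 23 3 → y ∈ padicBall 23 1 := by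
    intro y hy
    refine mem_padicBall_of_prime_mul (mem_padicBall_of_prime_mul ?_)
    convert hy using 1
    ring
  have h6 : (22 - 2 ^ 13 * 13 * ∑ j ∈ Finset.range (padicDigit x n),
      (2 : ℚ_[23]) ^ (j + 1) / ((j + 1 : ℕ) : ℚ_[23]) ^ 2) ∈ padicBall 23 1 := by
    refine h5 _ ?_
    convert h4 using 1
    push_cast
    ring
  rcases he with he | he
  · rw [he] at h6
    have : ((22 : ℕ) : ℚ_[23]) ∈ padicBall 23 1 := by simpa using h6
    rw [natCast_mem_padicBall] at this
    revert this
    decide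
  · rw [he] at h6
    -- `156080925 = 45045² / 13`, where 45045 is the odd part of `lcm(1, …, 13)`. The prefactor
    -- `2^13 * 13` absorbs the powers of 2 and one factor 13, so the product is an integer.
    have h7 := mul_left_mem_padicBall (norm_natCast_le_one 156080925) h6
    have e : ((156080925 : ℕ) : ℚ_[23]) * (22 - 2 ^ 13 * 13 * ∑ j ∈ Finset.range 13,
        (2 : ℚ_[23]) ^ (j + 1) / ((j + 1 : ℕ) : ℚ_[23]) ^ 2) = ((-2077136415665026 : ℤ) : ℚ_[23]) := by
      simp only [Finset.sum_range_succ, Finset.sum_range_zero]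
      norm_num
    rw [e, intCast_mem_padicBall] at h7
    revert h7
    decide

end TwentyThree

/-! ### The point `-1` -/

section NegOne

variable {p : ℕ} [hpp : Fact p.Prime]

theorem cauchySeq_of_sub_mem_padicBall {u : ℕ → ℚ_[p]}
    (h : ∀ n, u (n + 1) - u n ∈ padicBall p n) : CauchySeq u := by
  have hp : (1 : ℝ) < p := by exact_mod_cast hpp.out.one_lt
  refine cauchySeq_of_le_geometric (p : ℝ)⁻¹ 1 (inv_lt_one_of_one_lt₀ hp) fun n => ?_
  rw [dist_comm, dist_eq_norm, one_mul]
  exact h n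

/-- Each `p`-th power applied to `2^p ≡ 2` mod `p` gains a factor `p` in the modulus. -/
theorem two_pow_prime_pow_sub_mem (n : ℕ) :
    (2 : ℚ_[p]) ^ p ^ (n + 1) - 2 ^ p ^ n ∈ padicBall p (n + 1) := by
  have h : ((p ^ (n + 1) : ℕ) : ℤ) ∣ (2 : ℤ) ^ p ^ (n + 1) - 2 ^ p ^ n := by
    have h0 : ((p : ℕ) : ℤ) ∣ 2 ^ p - 2 := by
      rw [← ZMod.intCast_eq_intCast_iff_dvd_sub]
      push_cast
      rw [ZMod.pow_card]
    have h1 := dvd_sub_pow_of_dvd_sub h0 n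
    rw [← pow_mul, ← pow_succ'] at h1
    exact_mod_cast h1
  have := (intCast_mem_padicBall (p := p) (k := n + 1)).2 (by exact_mod_cast h)
  exact_mod_cast this

theorem appr_neg_one (n : ℕ) : (-1 : ℤ_[p]).appr n + 1 = p ^ n := by
  have h := sub_appr_mem (-1 : ℤ_[p]) n
  have h1 : (((-1 : ℤ_[p]).appr n + 1 : ℕ) : ℚ_[p]) ∈ padicBall p n := by
    convert neg_mem h using 1
    push_cast
    ring
  rw [natCast_mem_padicBall] at h1
  exact le_antisymm ((-1 : ℤ_[p]).appr_lt n) (Nat.le_of_dvd (Nat.succ_pos _) h1)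

/-- The factor `n + 1` in the closed form becomes `p^(n+1)`, exactly what makes `T` converge; the
limit of the denominators has norm 1, so division is harmless. -/
theorem isPDefinable_neg_one (hodd : Odd p) : IsPDefinable (-1 : ℤ_[p]) := by
  obtain ⟨a, ha⟩ := cauchySeq_tendsto_of_complete (cauchySeq_of_sub_mem_padicBall
    (u := fun n => (p : ℚ_[p]) ^ n * twoPowSum ℚ_[p] (p ^ n)) fun n => by
      simpa using padicBall_anti (show n ≤ n + 2 by omega)
        (pow_mul_twoPowSum_succ_sub_mem hodd n 1))
  obtain ⟨b, hb⟩ := cauchySeq_tendsto_of_complete (cauchySeq_of_sub_mem_padicBall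
    (u := fun n => (2 : ℚ_[p]) ^ p ^ n) fun n =>
      padicBall_anti (Nat.le_succ n) (two_pow_prime_pow_sub_mem n))
  have hb0 : b ≠ 0 := by
    have h1 : ‖b‖ = 1 := by
      refine tendsto_nhds_unique hb.norm ?_
      simp only [norm_two_pow_eq_one hodd]
      exact tendsto_const_nhds
    rw [← norm_ne_zero_iff, h1]
    exact one_ne_zero
  refine ⟨a / b, ?_⟩
  refine (((ha.div hb hb0).comp (tendsto_add_atTop_nat 1))).congr fun n => ?_
  simp only [Function.comp, Pi.div_apply]
  rw [padicPartialSum_eq_appr, cast_invBinomSum, appr_neg_one]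
  push_cast
  ring

end NegOne

theorem mainTheorem5 (p : ℕ) [Fact p.Prime] (hp : (Odd p ∧ IsGood p) ∨ p = 23) :
    (∀ x : ℤ_[p], x ≠ -1 → (∀ n : ℕ, x ≠ (n : ℤ_[p])) → ¬ IsPDefinable x) ∧
    {x : ℤ_[p] | (∀ n : ℕ, x ≠ (n : ℤ_[p])) ∧ IsPDefinable x} = {-1} := by
  have hodd : Odd p := by
    rcases hp with h | rfl
    · exact h.1
    · decide
  have main : ∀ x : ℤ_[p], x ≠ -1 → (∀ n : ℕ, x ≠ (n : ℤ_[p])) → ¬ IsPDefinable x := by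
    rcases hp with ⟨-, hg⟩ | rfl
    · intro x hx hx' h
      obtain ⟨n₀, hn₀⟩ := eventually_atTop.1 (eventually_twoPowSum_padicDigit_mem hodd hx h)
      obtain ⟨n, hn, hd⟩ := exists_padicDigit_ne_zero x hx' n₀
      exact hg.twoPowSum_notMem hodd hd (padicDigit_lt x n) (hn₀ n hn)
    · exact fun x hx hx' => not_isPDefinable_twentyThree hx hx'
  refine ⟨main, Set.eq_singleton_iff_unique_mem.2 ⟨⟨fun n h => ?_, isPDefinable_neg_one hodd⟩, ?_⟩⟩
  · have : ((n + 1 : ℕ) : ℤ_[p]) = 0 := by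
      push_cast
      rw [← h]
      ring
    exact Nat.succ_ne_zero n (by exact_mod_cast this)
  · rintro x ⟨hx, hdef⟩
    by_contra hne
    exact main x hne hx hdef
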